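/- Let $N\ge 2$, $R>0$, $B_R=\{x\in\mathbb R^N: |x|<R\}$. For a bounded open set $\Omega\subset\mathbb R^N$ with Lipschitz boundary and $f:\mathbb R\to\mathbb R$, a function $u\in BV(\Omega)$ is called a solution of $$-\operatorname{div}\Big(\frac{Du}{|Du|}\Big)=f(u)\ \text{ in }\Omega,\qquad u=0\ \text{ on }\partial\Omega, \tag{1}$$ with associated vector field $z\in L^\infty(\Omega;\mathbb R^N)$, $\|z\|_\infty\le 1$, if $f(u)\in L^N(\Omega)$ and (a) $-\operatorname{div} z=f(u)$ in $\mathcal D'(\Omega)$; (b) $(z,Du)=|Du|$ as measures on $\Omega$, where $\langle (z,Du),\varphi\rangle=-\int_\Omega u\,\varphi\operatorname{div}z-\int_\Omega u\,z\cdot\nabla\varphi$ for $\varphi\in C_c^\infty(\Omega)$; (c) $[z,\nu]\in\operatorname{sign}(-u)$ $\mathcal H^{N-1}$-a.e. on $\partial\Omega$, where $u|_{\partial\Omega}$ is the $BV$ trace, $[z,\nu]\in L^\infty(\partial\Omega)$ is the weak trace of the normal component of $z$ (the function satisfying $\int_\Omega z\cdot\nabla\varphi+\int_\Omega\varphi\operatorname{div}z=\int_{\partial\Omega}\varphi\,[z,\nu]\,d\mathcal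 H^{N-1}$ for all $\varphi\in C_c^\infty(\mathbb R^N)$), and $\operatorname{sign}$ is the multivalued sign, $\operatorname{sign}(0)=[-1,1]$. Then: 1. For every $q>0$ and $f(s)=|s|^{q-1}s$, the constant $u\equiv (N/R)^{1/q}>0$ is a positive solution of (1) in $\Omega=B_R$ with associated field $z(x)=-x/R$, and $u\equiv-(N/R)^{1/q}<0$ is a negative solution of (1) in $B_R$ with associated field $z(x)=x/R$. 2. Let $f:\mathbb R\to\mathbb R$ be continuous and strictly increasing, and let $u$ be a solution of (1) in $B_R$ that is a.e. equal to a constant $c$. If $c>0$, then $N/R$ lies in the range of $f$ and $c=f^{-1}(N/R)$. Symmetrically, if $c<0$, then $-N/R$ lies in the range of $f$ and $c=f^{-1}(-N/R)$. -/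

import Mathlib

open MeasureTheory Set Filter Topology TopologicalSpace
open scoped Distributions

noncomputable section

namespace OneLaplace

/-- Euclidean space `ℝ^N`. -/
abbrev Euc (N : ℕ) := EuclideanSpace ℝ (Fin N)

variable {N : ℕ}

/-- The measure `H^{N-1}` on `∂Ω`: the Hausdorff measure in its usual normalization
(the one that agrees with Lebesgue measure on `ℝ^{N-1}`), restricted to the boundary. -/
def boundaryMeasure (Ω : Opens (Euc N)) : Measure (Euc N) :=
  (μHE[N - 1] : Measure (Euc N)).restrict (frontier (Ω : Set (Euc N)))

/-- The vector measure `Du` on `Ω` is the distributional gradient of `u` in `Ω`, and is a bounded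
Radon measure: `∫_Ω u ∇φ dx = - ∫_Ω φ dDu` for all `φ ∈ C_c^∞(Ω)`. Measures on `Ω` are
encoded as measures on `ℝ^N` that are concentrated on `Ω`. -/
structure IsDistribGradient (Ω : Opens (Euc N)) (u : Euc N → ℝ)
    (Du : VectorMeasure (Euc N) (Euc N)) : Prop where
  concentrated : Du.restrict (Ω : Set (Euc N)) = Du
  finite : IsFiniteMeasure Du.variation
  integral_eq : ∀ φ : 𝓓(Ω, ℝ),
    ∫ x in (Ω : Set (Euc N)), u x • gradient (φ : Euc N → ℝ) x = -∫ᵛ x, φ x ∂•Du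

/-- `u ∈ BV(Ω)`. -/
def MemBV (Ω : Opens (Euc N)) (u : Euc N → ℝ) : Prop :=
  IntegrableOn u Ω ∧ ∃ Du : VectorMeasure (Euc N) (Euc N), IsDistribGradient Ω u Du

/-- `z ∈ L^∞(Ω; ℝ^N)` with `‖z‖_∞ ≤ 1`. -/
def IsUnitBounded (Ω : Opens (Euc N)) (z : Euc N → Euc N) : Prop :=
  AEStronglyMeasurable z (volume.restrict (Ω : Set (Euc N))) ∧
    ∀ᵐ x ∂(volume.restrict (Ω : Set (Euc N))), ‖z x‖ ≤ 1

/-- `div z = g` in `D'(Ω)`. -/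
def HasDistribDiv (Ω : Opens (Euc N)) (z : Euc N → Euc N) (g : Euc N → ℝ) : Prop :=
  ∀ φ : 𝓓(Ω, ℝ),
    ∫ x in (Ω : Set (Euc N)), inner ℝ (z x) (gradient (φ : Euc N → ℝ) x) =
      -∫ x in (Ω : Set (Euc N)), g x * φ x

/-- Anzellotti's distribution `(z, Du)` for a field `z` with `div z = g`:
`⟨(z, Du), φ⟩ = - ∫_Ω u φ div z - ∫_Ω u z · ∇φ`. -/
def anzellottiPairing (Ω : Opens (Euc N)) (z : Euc N → Euc N) (g u : Euc N → ℝ)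
    (φ : 𝓓(Ω, ℝ)) : ℝ :=
  -(∫ x in (Ω : Set (Euc N)), u x * φ x * g x) -
    ∫ x in (Ω : Set (Euc N)), u x * inner ℝ (z x) (gradient (φ : Euc N → ℝ) x)

/-- `τ ∈ L^1(∂Ω)` is the trace of `u ∈ BV(Ω)` on `∂Ω`: for `H^{N-1}`-almost every `x ∈ ∂Ω`,
the mean value of `|u - τ(x)|` over `B_r(x) ∩ Ω` tends to `0` as `r → 0+`. -/
def IsBoundaryTrace (Ω : Opens (Euc N)) (u τ : Euc N → ℝ) : Prop :=
  Integrable τ (boundaryMeasure Ω) ∧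
    ∀ᵐ x ∂(boundaryMeasure Ω),
      Tendsto (fun r : ℝ => ⨍ y in Metric.ball x r ∩ (Ω : Set (Euc N)), |u y - τ x|)
        (𝓝[>] 0) (𝓝 0)

/-- `θ ∈ L^∞(∂Ω)` is the weak trace `[z, ν]` of the normal component of a field `z` with
`div z = g`: the function on `∂Ω` determined by Green's formula
`∫_Ω z · ∇φ + ∫_Ω φ div z = ∫_{∂Ω} φ [z, ν] dH^{N-1}` for `φ ∈ C_c^∞(ℝ^N)`. -/
def IsWeakNormalTrace (Ω : Opens (Euc N)) (z : Euc N → Euc N) (g θ : Euc N → ℝ) : Prop :=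
  MemLp θ ⊤ (boundaryMeasure Ω) ∧
    ∀ φ : 𝓓((⊤ : Opens (Euc N)), ℝ),
      (∫ x in (Ω : Set (Euc N)), inner ℝ (z x) (gradient (φ : Euc N → ℝ) x)) +
          ∫ x in (Ω : Set (Euc N)), φ x * g x =
        ∫ x, φ x * θ x ∂(boundaryMeasure Ω)

/-- The multivalued sign. -/
def multiSign (s : ℝ) : Set ℝ :=
  if 0 < s then {1} else if s < 0 then {-1} else Icc (-1) 1

/-- The function `u ∈ BV(Ω)` is a solution, with associated vector field `z`, of
`-div (Du / |Du|) = f(x, u)` in `Ω`, `u = 0` on `∂Ω`, where `Ω` is a bounded open set with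
Lipschitz boundary. (The gradient `Du` and the traces are unique up to null sets.) The membership `f(·, u) ∈ L^N(Ω)`
together with (1) says that `div z ∈ L^N(Ω)`, so that `(z, Du)` and `[z, ν]` make sense. -/
structure IsSolutionPair (Ω : Opens (Euc N)) (f : Euc N → ℝ → ℝ) (u : Euc N → ℝ)
    (z : Euc N → Euc N) : Prop where
  memBV : MemBV Ω u
  unitBounded : IsUnitBounded Ω z
  memLp_source : MemLp (fun x => f x (u x)) N (volume.restrict (Ω : Set (Euc N)))
  /-- (1) `-div z = f(x, u)` in `D'(Ω)` -/
  equation : HasDistribDiv Ω z (fun x => -f x (u x))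
  /-- (2) `(z, Du) = |Du|` as measures on `Ω` -/
  pairing : ∃ Du : VectorMeasure (Euc N) (Euc N), IsDistribGradient Ω u Du ∧
    ∀ φ : 𝓓(Ω, ℝ),
      anzellottiPairing Ω z (fun x => -f x (u x)) u φ = ∫ x, φ x ∂Du.variation
  /-- (3) `[z, ν] ∈ sign(-u)` on `∂Ω` -/
  boundary : ∃ τ θ : Euc N → ℝ, IsBoundaryTrace Ω u τ ∧
    IsWeakNormalTrace Ω z (fun x => -f x (u x)) θ ∧
    ∀ᵐ x ∂(boundaryMeasure Ω), θ x ∈ multiSign (-τ x)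

/-- `u` is a solution of `-div (Du / |Du|) = f(x, u)` in `Ω`, `u = 0` on `∂Ω`. -/
def IsSolution (Ω : Opens (Euc N)) (f : Euc N → ℝ → ℝ) (u : Euc N → ℝ) : Prop :=
  ∃ z : Euc N → Euc N, IsSolutionPair Ω f u z

/-- The open ball `B_R` centred at the origin. -/
def openBall (N : ℕ) (R : ℝ) : Opens (Euc N) := ⟨Metric.ball 0 R, Metric.isOpen_ball⟩

end OneLaplace

end

/-! The field `k • x` has divergence `k * N` and normal component `k * R` on the sphere of radius
`R`. For `k = ∓1/R` its norm is at most one in the ball and its normal trace is `∓1`, which is what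
`multiSign (-c)` asks of a constant `c` of sign `±`. The equation then reads `f c = ±N/R`, and since
a constant has `Du = 0`, the pairing condition is that equation multiplied by `c`.

Conversely, a nonzero constant solution has boundary trace `c`, so its field has normal trace `-sign
c`. Green's formula with a cutoff equal to one near the closed ball gives `f c * |B_R| = sign c *
H(∂B_R)`. The same formula for the field `x` gives `N * |B_R| = R * H(∂B_R)`, hence `f c = sign c *
N/R` (`eq_of_isWeakNormalTrace_const`).

The substance is Green's formula for `k • x` with Hausdorff measure on the sphere. In polar
coordinates it is the fundamental theorem of calculus along rays, once Hausdorff measure is known to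
be the polar surface measure (`euclideanHausdorffMeasure_sphere_eq_toSphere`). Near a point of the
sphere a nearly isometric map turns thin conical sectors into cylinders whose height is exactly the
radial factor of the sector's volume. Comparing volumes and bases, then letting the distortion tend
to one, identifies the two measures. -/

open scoped NNReal ENNReal

/-! ### Hausdorff measure under bi-Lipschitz maps -/

section HausdorffLipschitz

variable {X Y : Type*} [MetricSpace X] [MeasurableSpace X] [BorelSpace X]
  [MetricSpace Y] [MeasurableSpace Y] [BorelSpace Y] {f : X → Y} {s : Set X} {K : ℝ≥0}

theorem LipschitzOnWith.euclideanHausdorffMeasure_image_le (h : LipschitzOnWith K f s) (d : ℕ) :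
    μHE[d] (f '' s) ≤ (K : ℝ≥0∞) ^ d * μHE[d] s := by
  simp_rw [Measure.euclideanHausdorffMeasure_def, Measure.smul_apply]
  have := h.hausdorffMeasure_image_le (d := d) (by simp)
  rw [ENNReal.rpow_natCast] at this
  rw [mul_smul_comm]
  gcongr

theorem euclideanHausdorffMeasure_le_image_of_dist_le
    (h : ∀ x ∈ s, ∀ y ∈ s, dist x y ≤ K * dist (f x) (f y)) (d : ℕ) :
    μHE[d] s ≤ (K : ℝ≥0∞) ^ d * μHE[d] (f '' s) := by
  have hanti : AntilipschitzWith K (s.domRestrict f) :=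
    AntilipschitzWith.of_le_mul_dist fun x y => h x x.2 y y.2
  have h1 := hanti.le_hausdorffMeasure_image (d := d) (by simp) univ
  rw [image_univ, range_domRestrict, ENNReal.rpow_natCast] at h1
  have h2 := (isometry_subtype_coe (s := s)).hausdorffMeasure_image (d := d)
    (Or.inl (by simp)) univ
  rw [image_univ, Subtype.range_coe] at h2
  simp_rw [Measure.euclideanHausdorffMeasure_def, Measure.smul_apply]
  rw [mul_smul_comm, h2]
  gcongr

end HausdorffLipschitz

/-! ### The flattening map and its distortion -/

section SphereFlattening

variable {E : Type*} [NormedAddCommGroup E] [InnerProductSpace ℝ E]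

/-- A map that flattens the unit sphere near its point `e`: it carries the points of norm `r` to
the hyperplane at height `r ^ n / n` orthogonal to `e`. -/
noncomputable def sphereFlattening (n : ℕ) (e y : E) : E :=
  (‖y‖⁻¹ • y - inner ℝ e (‖y‖⁻¹ • y) • e) + (‖y‖ ^ n / n) • e

theorem hasFDerivAt_norm_of_norm_eq_one {e : E} (he : ‖e‖ = 1) :
    HasFDerivAt (fun y : E => ‖y‖) (innerSL ℝ e) e := by
  have he0 : e ≠ 0 := by rintro rfl; simp at he
  have h1 : DifferentiableAt ℝ (fun y : E => ‖y‖) e :=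
    ((contDiffAt_norm ℝ he0).differentiableAt (n := 1) (by simp))
  -- Differentiating the squared norm in two ways determines the derivative of the norm.
  have h2 := h1.hasFDerivAt.pow 2
  have h3 := (hasStrictFDerivAt_norm_sq e).hasFDerivAt
  have h4 := h2.unique h3
  convert h1.hasFDerivAt using 1
  ext h
  have h5 := congrArg (fun L => L h) h4
  simp [he] at h5
  simpa using h5.symm

/-- At `e` the first summand differentiates to the orthogonal projection onto the complement of `e`,
the second to the projection onto `e`, because `r ^ n / n` has slope one at `r = 1`. -/
theorem hasStrictFDerivAt_sphereFlattening {n : ℕ} (hn : n ≠ 0) {e : E} (he : ‖e‖ = 1) :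
    HasStrictFDerivAt (sphereFlattening n e) (ContinuousLinearMap.id ℝ E) e := by
  have he0 : e ≠ 0 := by rintro rfl; simp at he
  have hc : ContDiffAt ℝ 1 (sphereFlattening n e) e := by
    have h1 : ContDiffAt ℝ 1 (fun y : E => ‖y‖) e := contDiffAt_norm ℝ he0
    have h2 : ContDiffAt ℝ 1 (fun y : E => ‖y‖⁻¹ • y) e :=
      (h1.inv (by simpa using he0)).smul contDiffAt_id
    unfold sphereFlattening
    exact (h2.sub ((contDiffAt_const.inner ℝ h2).smul contDiffAt_const)).add
      (((h1.pow n).div_const _).smul contDiffAt_const)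
  refine hc.hasStrictFDerivAt' ?_ (by simp)
  have h1 := hasFDerivAt_norm_of_norm_eq_one he
  have h2 : HasFDerivAt (fun y : E => ‖y‖⁻¹ • y) _ e :=
    ((hasDerivAt_inv (by simpa using he0)).comp_hasFDerivAt e h1).smul (hasFDerivAt_id e)
  have h3 := ((hasFDerivAt_const e e).inner ℝ h2).smul (hasFDerivAt_const e e)
  have h4 := ((h1.pow n).mul_const ((n : ℝ)⁻¹)).smul (hasFDerivAt_const e e)
  unfold sphereFlattening
  simp_rw [div_eq_mul_inv]
  refine ((h2.sub h3).add h4).congr_fderiv ?_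
  ext h
  have : (n : ℝ) ≠ 0 := by exact_mod_cast hn
  simp [he, fderivInnerCLM_apply, inner_smul_right, inner_add_right,
    this]

/-- The part orthogonal to `e` depends on the direction of `y` only, so radial motion becomes
translation along `e`. The height `r ^ n / n` is the primitive of the polar weight `r ^ (n - 1)`. -/
theorem sphereFlattening_smul {n : ℕ} {e y : E} (hy : ‖y‖ = 1) {r : ℝ} (hr : 0 < r) :
    sphereFlattening n e (r • y) = sphereFlattening n e y + (r ^ n / n - 1 / n) • e := by
  have : r⁻¹ • r • y = y := by rw [smul_smul, inv_mul_cancel₀ hr.ne', one_smul]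
  simp only [sphereFlattening, norm_smul, hy, Real.norm_eq_abs, abs_of_pos hr, mul_one, this,
    inv_one, one_smul, one_pow, sub_smul]
  abel

theorem inner_sphereFlattening {n : ℕ} {e : E} (he : ‖e‖ = 1) (y : E) :
    inner ℝ e (sphereFlattening n e y) = ‖y‖ ^ n / n := by
  simp [sphereFlattening, inner_add_right, inner_sub_right, inner_smul_right, he]


theorem exists_sphereFlattening_bilipschitz {n : ℕ} (hn : n ≠ 0) {e : E} (he : ‖e‖ = 1)
    {K : ℝ≥0} (hK : 1 < K) :
    ∃ ρ > 0, LipschitzOnWith K (sphereFlattening n e) (Metric.ball e ρ) ∧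
      ∀ x ∈ Metric.ball e ρ, ∀ y ∈ Metric.ball e ρ,
        dist x y ≤ K * dist (sphereFlattening n e x) (sphereFlattening n e y) := by
  have hK' : (1 : ℝ) < K := by exact_mod_cast hK
  -- This `c` serves both estimates: `1 + c ≤ K` for the upper one and `1 - c = K⁻¹` for the lower
  -- one.
  set c : ℝ≥0 := 1 - K⁻¹ with hc
  have hKi : K⁻¹ < 1 := inv_lt_one_of_one_lt₀ hK
  have hcr : (c : ℝ) = 1 - (K : ℝ)⁻¹ := by rw [hc, NNReal.coe_sub hKi.le]; simp
  have hc0 : 0 < c := tsub_pos_of_lt hKi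
  obtain ⟨s, hs, h⟩ := (hasStrictFDerivAt_sphereFlattening hn he).approximates_deriv_on_nhds
    (Or.inr hc0)
  obtain ⟨ρ, hρ, hsub⟩ := Metric.mem_nhds_iff.1 hs
  have hK0 : (0 : ℝ) < K := by linarith
  have key : ∀ x ∈ Metric.ball e ρ, ∀ y ∈ Metric.ball e ρ,
      ‖sphereFlattening n e x - sphereFlattening n e y - (x - y)‖ ≤ c * ‖x - y‖ :=
    fun x hx y hy => by simpa using h x (hsub hx) y (hsub hy)
  have hcK : 1 + (c : ℝ) ≤ K := by
    have : (K : ℝ) * (K : ℝ)⁻¹ = 1 := mul_inv_cancel₀ hK0.ne'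
    rw [hcr]; nlinarith [inv_pos.2 hK0]
  refine ⟨ρ, hρ, LipschitzOnWith.of_dist_le_mul fun x hx y hy => ?_, fun x hx y hy => ?_⟩
  · have h1 := key x hx y hy
    have h2 := norm_le_norm_add_norm_sub' (sphereFlattening n e x - sphereFlattening n e y) (x - y)
    rw [dist_eq_norm, dist_eq_norm]
    nlinarith [norm_nonneg (x - y)]
  · have h1 := key x hx y hy
    have h2 := norm_le_norm_add_norm_sub (sphereFlattening n e x - sphereFlattening n e y) (x - y)
    rw [dist_eq_norm, dist_eq_norm]
    have h3 : (K : ℝ)⁻¹ * ‖x - y‖ ≤ ‖sphereFlattening n e x - sphereFlattening n e y‖ := by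
      rw [hcr] at h1; linarith
    calc ‖x - y‖ = K * ((K : ℝ)⁻¹ * ‖x - y‖) := by field_simp
      _ ≤ _ := by gcongr

end SphereFlattening

/-! ### Hausdorff measure and polar surface measure on the unit sphere -/

section SphereMeasure

open scoped Pointwise

variable {E : Type*} [NormedAddCommGroup E] [InnerProductSpace ℝ E] [FiniteDimensional ℝ E]
  [MeasurableSpace E] [BorelSpace E]

omit [FiniteDimensional ℝ E] [MeasurableSpace E] [BorelSpace E] in
theorem Ico_smul_image_coe_eq (A : Set (Metric.sphere (0 : E) 1)) {a : ℝ} (ha : 0 < a) :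
    Ico a 1 • ((↑) '' A : Set E) = (↑) '' (homeomorphUnitSphereProd E ⁻¹'
      (A ×ˢ ((↑) ⁻¹' Ico a 1 : Set (Ioi (0 : ℝ))))) := by
  ext y
  simp only [Set.mem_smul, mem_image]
  constructor
  · rintro ⟨r, hr, -, ⟨ω, hω, rfl⟩, rfl⟩
    refine ⟨(homeomorphUnitSphereProd E).symm (ω, ⟨r, ha.trans_le hr.1⟩), ?_, ?_⟩
    · simp only [mem_preimage, Homeomorph.apply_symm_apply]
      exact ⟨hω, hr⟩
    · simp
  · rintro ⟨x, hx, rfl⟩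
    refine ⟨_, hx.2, _, ⟨_, hx.1, rfl⟩, ?_⟩
    rw [← homeomorphUnitSphereProd_symm_apply_coe, Homeomorph.symm_apply_apply]

theorem measurableSet_Ico_smul_image_coe {A : Set (Metric.sphere (0 : E) 1)}
    (hA : MeasurableSet A) {a : ℝ} (ha : 0 < a) :
    MeasurableSet (Ico a 1 • ((↑) '' A : Set E)) := by
  rw [Ico_smul_image_coe_eq A ha]
  refine (MeasurableEmbedding.subtype_coe (measurableSet_singleton _).compl).measurableSet_image.2 ?_
  exact (homeomorphUnitSphereProd E).measurable
    (hA.prod (measurable_subtype_coe measurableSet_Ico))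

theorem volumeIoiPow_preimage_Ico (n : ℕ) {a b : ℝ} (ha : 0 < a) (hab : a ≤ b) :
    Measure.volumeIoiPow n ((↑) ⁻¹' Ico a b : Set (Ioi (0 : ℝ))) =
      ENNReal.ofReal (b ^ (n + 1) / (n + 1) - a ^ (n + 1) / (n + 1)) := by
  have h : ((↑) ⁻¹' Ico a b : Set (Ioi (0 : ℝ))) =
      Iio ⟨b, mem_Ioi.2 (ha.trans_le hab)⟩ \ Iio ⟨a, mem_Ioi.2 ha⟩ := by
    ext x
    simp only [mem_preimage, mem_Ico, Set.mem_sdiff, mem_Iio, not_lt, ← Subtype.coe_lt_coe]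
    tauto
  have hle : (⟨a, mem_Ioi.2 ha⟩ : Ioi (0 : ℝ)) ≤ ⟨b, mem_Ioi.2 (ha.trans_le hab)⟩ := hab
  rw [h, measure_sdiff (Iio_subset_Iio hle) measurableSet_Iio.nullMeasurableSet
    (by simp [Measure.volumeIoiPow_apply_Iio]), Measure.volumeIoiPow_apply_Iio,
    Measure.volumeIoiPow_apply_Iio, ENNReal.ofReal_sub _ (by positivity)]

theorem volume_Ico_smul_image_coe [Nontrivial E] {A : Set (Metric.sphere (0 : E) 1)}
    (hA : MeasurableSet A) {a : ℝ} (ha : 0 < a) (ha1 : a ≤ 1) :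
    volume (Ico a 1 • ((↑) '' A : Set E)) = (volume : Measure E).toSphere A *
      ENNReal.ofReal (1 / Module.finrank ℝ E - a ^ Module.finrank ℝ E / Module.finrank ℝ E) := by
  have hm : MeasurableSet (A ×ˢ ((↑) ⁻¹' Ico a 1 : Set (Ioi (0 : ℝ)))) :=
    hA.prod (measurable_subtype_coe measurableSet_Ico)
  have hd : Module.finrank ℝ E - 1 + 1 = Module.finrank ℝ E :=
    Nat.sub_add_cancel Module.finrank_pos
  have hd' : ((Module.finrank ℝ E - 1 : ℕ) : ℝ) + 1 = Module.finrank ℝ E := by exact_mod_cast hd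
  rw [Ico_smul_image_coe_eq A ha, ← comap_subtype_coe_apply (measurableSet_singleton _).compl,
    (Measure.measurePreserving_homeomorphUnitSphereProd volume).measure_preimage
      hm.nullMeasurableSet, Measure.prod_prod, volumeIoiPow_preimage_Ico _ ha ha1, hd, hd', one_pow]

/-- Slice by hyperplanes orthogonal to `e`: the slices at heights in `[a ^ n / n, 1 / n)` are
translates of the flattened base, and the others are empty. -/
theorem volume_sphereFlattening_image [Nontrivial E] {e : E} (he : ‖e‖ = 1)
    {A : Set (Metric.sphere (0 : E) 1)} {a : ℝ} (ha : 0 < a)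
    (hm : MeasurableSet (sphereFlattening (Module.finrank ℝ E) e ''
      (Ico a 1 • ((↑) '' A : Set E)))) :
    volume (sphereFlattening (Module.finrank ℝ E) e '' (Ico a 1 • ((↑) '' A : Set E))) =
      μHE[Module.finrank ℝ E - 1] (sphereFlattening (Module.finrank ℝ E) e '' ((↑) '' A)) *
      ENNReal.ofReal (1 / Module.finrank ℝ E - a ^ Module.finrank ℝ E / Module.finrank ℝ E) := by
  set n := Module.finrank ℝ E with hn
  have hn0 : n ≠ 0 := Module.finrank_pos.ne'
  have hnr : (0 : ℝ) < n := by positivity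
  have he0 : e ≠ 0 := by rintro rfl; simp at he
  set t := sphereFlattening n e '' (Ico a 1 • ((↑) '' A : Set E)) with ht
  set B := sphereFlattening n e '' ((↑) '' A : Set E) with hB
  have hmem (x : ℝ) (y : E) :
      y ∈ AffineSubspace.mk' (x • e +ᵥ (0 : E)) (ℝ ∙ e)ᗮ ↔ inner ℝ e y = x := by
    rw [AffineSubspace.mem_mk', Submodule.mem_orthogonal_singleton_iff_inner_right]
    simp [inner_sub_right, inner_smul_right, he, sub_eq_zero]
  have hslice (x : ℝ) : μHE[n - 1] (t ∩ AffineSubspace.mk' (x • e +ᵥ (0 : E)) (ℝ ∙ e)ᗮ) =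
      (Ico (a ^ n / n) (1 / n)).indicator (fun _ => μHE[n - 1] B) x := by
    by_cases hx : x ∈ Ico (a ^ n / n) (1 / n)
    · have h1 : t ∩ AffineSubspace.mk' (x • e +ᵥ (0 : E)) (ℝ ∙ e)ᗮ =
          (fun p => p + (x - 1 / n) • e) '' B := by
        have hpos : 0 ≤ n * x := by
          have := (by positivity : 0 ≤ a ^ n / n).trans hx.1
          positivity
        have hx1 : n * x < 1 := by
          have := (lt_div_iff₀ hnr).1 hx.2; linarith
        have hx2 : a ^ n ≤ n * x := by
          have := (div_le_iff₀ hnr).1 hx.1; linarith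
        ext y
        simp only [mem_inter_iff, SetLike.mem_coe, hmem, hB, ht, mem_image, Set.mem_smul]
        constructor
        · rintro ⟨⟨-, ⟨r, hr, -, ⟨ω, hω, rfl⟩, rfl⟩, rfl⟩, hy⟩
          refine ⟨_, ⟨_, ⟨ω, hω, rfl⟩, rfl⟩, ?_⟩
          have hr0 : 0 < r := ha.trans_le hr.1
          have hω1 : ‖(ω : E)‖ = 1 := by simp
          rw [inner_sphereFlattening he, norm_smul, hω1, mul_one, Real.norm_eq_abs,
            abs_of_pos hr0] at hy
          rw [sphereFlattening_smul hω1 hr0, hy]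
        · rintro ⟨-, ⟨-, ⟨ω, hω, rfl⟩, rfl⟩, rfl⟩
          have hω1 : ‖(ω : E)‖ = 1 := by simp
          -- The radius whose flattened height `r ^ n / n` is `x`.
          set r : ℝ := (n * x) ^ ((n : ℝ)⁻¹) with hr
          have hrn : r ^ n = n * x := Real.rpow_inv_natCast_pow hpos hn0
          have hr0 : 0 ≤ r := by positivity
          have har : a ≤ r := le_of_pow_le_pow_left₀ hn0 hr0 (by rwa [hrn])
          have hr1 : r < 1 := lt_of_pow_lt_pow_left₀ n zero_le_one (by rwa [hrn, one_pow])
          refine ⟨⟨_, ⟨r, ⟨har, hr1⟩, _, ⟨ω, hω, rfl⟩, rfl⟩, ?_⟩, ?_⟩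
          · rw [sphereFlattening_smul hω1 (ha.trans_le har), hrn,
              mul_div_cancel_left₀ _ hnr.ne']
          · rw [inner_add_right, inner_sphereFlattening he, inner_smul_right,
              real_inner_self_eq_norm_sq, he, hω1]
            simp
      rw [h1, indicator_of_mem hx]
      exact (isometry_add_right _).euclideanHausdorffMeasure_image _
    · rw [indicator_of_notMem hx]
      refine (congrArg _ (eq_empty_iff_forall_notMem.2 ?_)).trans measure_empty
      rintro y ⟨⟨-, ⟨r, hr, -, ⟨ω, hω, rfl⟩, rfl⟩, rfl⟩, hy⟩
      have hr0 : 0 < r := ha.trans_le hr.1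
      have hω1 : ‖(ω : E)‖ = 1 := by simp
      rw [SetLike.mem_coe, hmem, inner_sphereFlattening he] at hy
      simp only [norm_smul, hω1, mul_one, Real.norm_eq_abs, abs_of_pos hr0] at hy
      apply hx
      rw [← hy]
      exact ⟨by gcongr; exact hr.1, by gcongr; exact pow_lt_one₀ hr0.le hr.2 hn0⟩
  have h := EuclideanGeometry.euclideanHausdorffMeasure_eq_lintegral (0 : E) he0 hm
  rw [InnerProductSpace.euclideanHausdorffMeasure_eq_volume] at h
  rw [h, ← hn]
  simp_rw [hslice]
  rw [lintegral_indicator measurableSet_Ico, setLIntegral_const, Real.volume_Ico,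
    enorm_eq_iff_norm_eq.2 (he.trans norm_one.symm : ‖e‖ = ‖(1 : ℝ)‖)]
  simp

/-- Second countability leaves countably many neighbourhoods; made disjoint, they let the local
inequalities be summed. -/
theorem MeasureTheory.Measure.le_of_forall_exists_mem_nhds {X : Type*} [TopologicalSpace X]
    [SecondCountableTopology X] [MeasurableSpace X] [OpensMeasurableSpace X] {μ ν : Measure X}
    (h : ∀ x, ∃ U ∈ 𝓝 x, ∀ s ⊆ U, MeasurableSet s → μ s ≤ ν s) : μ ≤ ν := by
  choose U hU hle using h
  obtain ⟨t, ht, hcov⟩ := TopologicalSpace.countable_cover_nhds fun x => interior_mem_nhds.2 (hU x)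
  rcases t.eq_empty_or_nonempty with rfl | hne
  · have : IsEmpty X := univ_eq_empty_iff.1 (by simpa using hcov.symm)
    rw [Subsingleton.elim μ ν]
  obtain ⟨x, rfl⟩ := ht.exists_eq_range hne
  set V : ℕ → Set X := disjointed fun n => interior (U (x n))
  have hVm : ∀ n, MeasurableSet (V n) :=
    fun n => MeasurableSet.disjointed (fun n => isOpen_interior.measurableSet) n
  have hV : ⋃ n, V n = univ := by
    rw [iUnion_disjointed, ← hcov, biUnion_range]
  refine Measure.le_iff.2 fun s hs => ?_
  have hs' : s = ⋃ n, s ∩ V n := by rw [← inter_iUnion, hV, inter_univ]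
  have hd : Pairwise (Function.onFun Disjoint fun n => s ∩ V n) := fun i j hij =>
    ((disjoint_disjointed _) hij).mono inter_subset_right inter_subset_right
  rw [hs', measure_iUnion hd fun n => hs.inter (hVm n),
    measure_iUnion hd fun n => hs.inter (hVm n)]
  exact ENNReal.tsum_le_tsum fun n => hle (x n) _ (inter_subset_right.trans
    ((disjointed_subset _ n).trans interior_subset)) (hs.inter (hVm n))

/-- The sector over `A` and its flattened cylinder have the same radial factor, which cancels.
Comparing their volumes costs `K ^ n` and comparing `A` with the flattened base costs `K ^ (n - 1)`,
hence the exponent `2 * n - 1`. -/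
theorem exists_nhds_toSphere_bounds [Nontrivial E] (e : Metric.sphere (0 : E) 1) {K : ℝ≥0}
    (hK : 1 < K) :
    ∃ U ∈ 𝓝 e, ∀ A ⊆ U, MeasurableSet A →
      (volume : Measure E).toSphere A ≤ (K : ℝ≥0∞) ^ (2 * Module.finrank ℝ E - 1) *
        μHE[Module.finrank ℝ E - 1] A ∧
      μHE[Module.finrank ℝ E - 1] A ≤ (K : ℝ≥0∞) ^ (2 * Module.finrank ℝ E - 1) *
        (volume : Measure E).toSphere A := by
  have he : ‖(e : E)‖ = 1 := by simp
  obtain ⟨ρ, hρ, hlip, hanti⟩ := exists_sphereFlattening_bilipschitz (n := Module.finrank ℝ E)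
    Module.finrank_pos.ne' he hK
  refine ⟨Metric.ball e (ρ / 2), Metric.ball_mem_nhds _ (by positivity), fun A hAU hA => ?_⟩
  set n := Module.finrank ℝ E with hn
  have hn0 : n ≠ 0 := Module.finrank_pos.ne'
  have hnr : (0 : ℝ) < n := by positivity
  -- The sector is thin: half of `ρ` is spent on the spread of `A`, half on the radial displacement.
  obtain ⟨a, ha, ha1, haρ⟩ : ∃ a : ℝ, 0 < a ∧ a < 1 ∧ 1 - a ≤ ρ / 2 :=
    ⟨max (1 / 2) (1 - ρ / 2), by positivity, max_lt (by norm_num) (by linarith),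
      by linarith [le_max_right (1 / 2) (1 - ρ / 2)]⟩
  set T : Set E := Ico a 1 • ((↑) '' A : Set E) with hT
  have hTm : MeasurableSet T := measurableSet_Ico_smul_image_coe hA ha
  have hTρ : T ⊆ Metric.ball (e : E) ρ := by
    rintro y hy
    obtain ⟨r, hr, -, ⟨ω, hω, rfl⟩, rfl⟩ := Set.mem_smul.1 hy
    have h1 : dist (ω : E) e < ρ / 2 := hAU hω
    have h2 : dist (r • (ω : E)) ω ≤ ρ / 2 := by
      have : r • (ω : E) - ω = (r - 1) • (ω : E) := by rw [sub_smul, one_smul]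
      rw [dist_eq_norm, this, norm_smul, norm_eq_of_mem_sphere, mul_one, Real.norm_eq_abs,
        abs_of_nonpos (by linarith [hr.2])]
      linarith [hr.1]
    rw [Metric.mem_ball]
    linarith [dist_triangle (r • (ω : E)) ω e]
  have hAρ : ((↑) '' A : Set E) ⊆ Metric.ball (e : E) ρ := by
    rintro - ⟨ω, hω, rfl⟩
    have h1 : dist (ω : E) e < ρ / 2 := hAU hω
    rw [Metric.mem_ball]
    linarith
  -- Injectivity makes the image of the Borel set `T` Borel, as the slicing formula requires.
  have hinj : InjOn (sphereFlattening n (e : E)) T := fun x hx y hy hxy => by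
    have := hanti x (hTρ hx) y (hTρ hy)
    rw [hxy, dist_self, mul_zero] at this
    exact dist_le_zero.1 this
  have hΦT : MeasurableSet (sphereFlattening n (e : E) '' T) :=
    hTm.image_of_continuousOn_injOn (hlip.continuousOn.mono hTρ) hinj
  have hcyl := volume_sphereFlattening_image he ha hΦT
  have hsec := volume_Ico_smul_image_coe hA ha ha1.le
  rw [← hn] at hcyl hsec
  set c : ℝ≥0∞ := ENNReal.ofReal (1 / n - a ^ n / n) with hc
  have hc0 : c ≠ 0 := by
    have : a ^ n / n < 1 / n := by gcongr; exact pow_lt_one₀ ha.le ha1 hn0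
    simpa [hc] using this
  have hct : c ≠ ⊤ := ENNReal.ofReal_ne_top
  have hAeq : μHE[n - 1] ((↑) '' A : Set E) = μHE[n - 1] A :=
    isometry_subtype_coe.euclideanHausdorffMeasure_image A
  have h1 := (hlip.mono hTρ).euclideanHausdorffMeasure_image_le n
  have h2 := euclideanHausdorffMeasure_le_image_of_dist_le
    (fun x hx y hy => hanti x (hTρ hx) y (hTρ hy)) n
  have h3 := (hlip.mono hAρ).euclideanHausdorffMeasure_image_le (n - 1)
  have h4 := euclideanHausdorffMeasure_le_image_of_dist_le
    (fun x hx y hy => hanti x (hAρ hx) y (hAρ hy)) (n - 1)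
  rw [hn, InnerProductSpace.euclideanHausdorffMeasure_eq_volume, ← hn, hcyl, hsec] at h1 h2
  rw [hAeq] at h3 h4
  rw [← mul_assoc, ENNReal.mul_le_mul_iff_left hc0 hct] at h1 h2
  have hpow : (K : ℝ≥0∞) ^ (2 * n - 1) = K ^ n * K ^ (n - 1) := by
    rw [← pow_add]; congr 1; omega
  rw [hpow]
  constructor
  · rw [mul_assoc]; exact h2.trans (by gcongr)
  · rw [mul_comm ((K : ℝ≥0∞) ^ n), mul_assoc]; exact h4.trans (by gcongr)

/-- On the unit sphere, the Euclidean Hausdorff measure of codimension one is the surface measure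
given by polar coordinates. -/
theorem euclideanHausdorffMeasure_sphere_eq_toSphere [Nontrivial E] :
    (μHE[Module.finrank ℝ E - 1] : Measure (Metric.sphere (0 : E) 1)) =
      (volume : Measure E).toSphere := by
  set m := 2 * Module.finrank ℝ E - 1
  have hlim (x : ℝ≥0∞) : Tendsto (fun K : ℝ≥0 => (K : ℝ≥0∞) ^ m * x) (𝓝[>] 1) (𝓝 x) := by
    have h : Tendsto (fun K : ℝ≥0 => (K : ℝ≥0∞) ^ m) (𝓝[>] 1) (𝓝 1) := by
      have : Continuous fun K : ℝ≥0 => (K : ℝ≥0∞) ^ m :=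
        (ENNReal.continuous_pow m).comp ENNReal.continuous_coe
      simpa using (this.tendsto 1).mono_left nhdsWithin_le_nhds
    simpa using ENNReal.Tendsto.mul_const h (Or.inl one_ne_zero)
  -- For each `K > 1` the local bounds patch to a global one; then `K` decreases to one.
  refine le_antisymm (Measure.le_iff.2 fun s hs => ge_of_tendsto (hlim _) ?_)
    (Measure.le_iff.2 fun s hs => ge_of_tendsto (hlim _) ?_)
  · filter_upwards [self_mem_nhdsWithin] with K hK
    have : (μHE[Module.finrank ℝ E - 1] : Measure (Metric.sphere (0 : E) 1)) ≤
        (K : ℝ≥0∞) ^ m • (volume : Measure E).toSphere :=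
      Measure.le_of_forall_exists_mem_nhds fun e => by
        obtain ⟨U, hU, h⟩ := exists_nhds_toSphere_bounds e hK
        exact ⟨U, hU, fun A hAU hA => (h A hAU hA).2⟩
    exact this s
  · filter_upwards [self_mem_nhdsWithin] with K hK
    have : (volume : Measure E).toSphere ≤ (K : ℝ≥0∞) ^ m •
        (μHE[Module.finrank ℝ E - 1] : Measure (Metric.sphere (0 : E) 1)) :=
      Measure.le_of_forall_exists_mem_nhds fun e => by
        obtain ⟨U, hU, h⟩ := exists_nhds_toSphere_bounds e hK
        exact ⟨U, hU, fun A hAU hA => (h A hAU hA).1⟩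
    exact this s

end SphereMeasure

/-! ### Polar integration and the divergence theorem on balls -/

section Polar

open scoped Pointwise

variable {E : Type*} [NormedAddCommGroup E] [InnerProductSpace ℝ E] [FiniteDimensional ℝ E]
  [MeasurableSpace E] [BorelSpace E]

theorem euclideanHausdorffMeasure_restrict_sphere [Nontrivial E] {R : ℝ} (hR : 0 < R) :
    (μHE[Module.finrank ℝ E - 1] : Measure E).restrict (Metric.sphere 0 R) =
      ENNReal.ofReal (R ^ (Module.finrank ℝ E - 1)) •
        (volume : Measure E).toSphere.map (fun ω : Metric.sphere (0 : E) 1 => R • (ω : E)) := by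
  ext s hs
  have hm : Measurable fun ω : Metric.sphere (0 : E) 1 => R • (ω : E) := by fun_prop
  have h : s ∩ Metric.sphere 0 R =
      R • ((↑) '' ((fun ω : Metric.sphere (0 : E) 1 => R • (ω : E)) ⁻¹' s) : Set E) := by
    ext y
    rw [Set.mem_smul_set]
    constructor
    · rintro ⟨hy, hy'⟩
      have hyR : ‖R⁻¹ • y‖ = 1 := by
        rw [norm_smul, norm_inv, Real.norm_eq_abs, abs_of_pos hR, mem_sphere_zero_iff_norm.1 hy',
          inv_mul_cancel₀ hR.ne']
      refine ⟨R⁻¹ • y, ⟨⟨R⁻¹ • y, by simpa using hyR⟩, ?_, rfl⟩, ?_⟩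
      · simpa [smul_smul, hR.ne'] using hy
      · simp [smul_smul, hR.ne']
    · rintro ⟨-, ⟨ω, hω, rfl⟩, rfl⟩
      exact ⟨hω, by simp [norm_smul, abs_of_pos hR]⟩
  rw [Measure.restrict_apply hs, h, Measure.euclideanHausdorffMeasure_smul₀ _ hR.ne',
    isometry_subtype_coe.euclideanHausdorffMeasure_image,
    euclideanHausdorffMeasure_sphere_eq_toSphere, Measure.smul_apply, Measure.map_apply hm hs,
    ENNReal.ofReal_pow hR.le, ← Real.enorm_of_nonneg hR.le]
  rfl

theorem integral_euclideanHausdorffMeasure_sphere [Nontrivial E] {R : ℝ} (hR : 0 < R) (ψ : E → ℝ) :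
    ∫ x in Metric.sphere 0 R, ψ x ∂μHE[Module.finrank ℝ E - 1] =
      R ^ (Module.finrank ℝ E - 1) * ∫ ω, ψ (R • (ω : E)) ∂(volume : Measure E).toSphere := by
  have hemb : MeasurableEmbedding fun ω : Metric.sphere (0 : E) 1 => R • (ω : E) :=
    (Homeomorph.smulOfNeZero R hR.ne').measurableEmbedding.comp
      (MeasurableEmbedding.subtype_coe Metric.isClosed_sphere.measurableSet)
  rw [euclideanHausdorffMeasure_restrict_sphere hR, integral_smul_measure, hemb.integral_map,
    ENNReal.toReal_ofReal (by positivity), smul_eq_mul]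

theorem integral_volumeIoiPow_eq_setIntegral (n : ℕ) (g : ℝ → ℝ) :
    ∫ r : Ioi (0 : ℝ), g r ∂Measure.volumeIoiPow n = ∫ r in Ioi (0 : ℝ), r ^ n * g r := by
  simp only [Measure.volumeIoiPow, ENNReal.ofReal]
  rw [integral_withDensity_eq_integral_smul,
    integral_subtype_comap measurableSet_Ioi fun a ↦ Real.toNNReal (a ^ n) • g a,
    setIntegral_congr_fun measurableSet_Ioi fun x hx ↦ ?_]
  · rw [NNReal.smul_def, Real.coe_toNNReal _ (pow_nonneg hx.out.le _), smul_eq_mul]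
  · exact (measurable_subtype_coe.pow_const _).real_toNNReal

/-- Integration over a ball in polar coordinates. -/
theorem setIntegral_ball_eq_integral_toSphere [Nontrivial E] {R : ℝ} (hR : 0 < R) {F : E → ℝ}
    (hF : IntegrableOn F (Metric.ball 0 R)) :
    ∫ x in Metric.ball 0 R, F x = ∫ ω, (∫ r in (0 : ℝ)..R,
      r ^ (Module.finrank ℝ E - 1) * F (r • (ω : E))) ∂(volume : Measure E).toSphere := by
  set G : E → ℝ := (Metric.ball 0 R).indicator F with hG
  have hGi : Integrable G := (integrable_indicator_iff Metric.isOpen_ball.measurableSet).2 hF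
  have hmp := Measure.measurePreserving_homeomorphUnitSphereProd (volume : Measure E)
  have hemb := (homeomorphUnitSphereProd E).measurableEmbedding
  set g : Metric.sphere (0 : E) 1 × Ioi (0 : ℝ) → ℝ := fun p => G ((p.2 : ℝ) • (p.1 : E)) with hg
  have hcomp : g ∘ homeomorphUnitSphereProd E = fun x : ({0}ᶜ : Set E) => G (x : E) := by
    ext x
    simp only [hg, Function.comp, ← homeomorphUnitSphereProd_symm_apply_coe,
      Homeomorph.symm_apply_apply]
  have hgi : Integrable g ((volume : Measure E).toSphere.prod
      (Measure.volumeIoiPow (Module.finrank ℝ E - 1))) := by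
    rw [← hmp.integrable_comp_emb hemb, hcomp]
    exact (integrableOn_iff_comap_subtypeVal (measurableSet_singleton _).compl).1 hGi.integrableOn
  have h1 : ∫ x in Metric.ball 0 R, F x = ∫ p, g p ∂((volume : Measure E).toSphere.prod
      (Measure.volumeIoiPow (Module.finrank ℝ E - 1))) := by
    rw [← hmp.integral_comp hemb, ← integral_indicator Metric.isOpen_ball.measurableSet]
    rw [show (fun x => g (homeomorphUnitSphereProd E x)) = fun x : ({0}ᶜ : Set E) => G (x : E) from hcomp]
    rw [integral_subtype_comap (measurableSet_singleton _).compl G, restrict_compl_singleton]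
  rw [h1, integral_prod _ hgi]
  congr 1 with ω
  simp only [hg]
  rw [integral_volumeIoiPow_eq_setIntegral _ fun r => G (r • (ω : E)),
    intervalIntegral.integral_of_le hR.le, ← integral_Ioc_eq_integral_Ioo.symm,
    ← integral_indicator measurableSet_Ioi, ← integral_indicator measurableSet_Ioo]
  congr 1 with r
  by_cases hr : 0 < r
  · by_cases hrR : r < R <;> simp [hr, hrR, hG, indicator, norm_smul, abs_of_pos hr]
  · simp [hr]

/-- The divergence theorem on a ball for the radial fields `φ x • x`. -/
theorem setIntegral_ball_fderiv_apply_add_mul [Nontrivial E] {R : ℝ} (hR : 0 < R) {φ : E → ℝ}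
    (hφ : ContDiff ℝ 1 φ) :
    ∫ x in Metric.ball 0 R, (fderiv ℝ φ x x + Module.finrank ℝ E * φ x) =
      R * ∫ x in Metric.sphere 0 R, φ x ∂μHE[Module.finrank ℝ E - 1] := by
  set n := Module.finrank ℝ E with hn
  have hd : n - 1 + 1 = n := Nat.sub_add_cancel Module.finrank_pos
  have hcf : Continuous (fderiv ℝ φ) := hφ.continuous_fderiv (by simp)
  have hcφ : Continuous φ := hφ.continuous
  have hc : Continuous fun x => fderiv ℝ φ x x + n * φ x := by fun_prop
  have hi : IntegrableOn (fun x => fderiv ℝ φ x x + n * φ x) (Metric.ball 0 R) :=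
    (hc.locallyIntegrable.integrableOn_isCompact (isCompact_closedBall (0 : E) R)).mono_set
      Metric.ball_subset_closedBall
  rw [setIntegral_ball_eq_integral_toSphere hR hi, hn, integral_euclideanHausdorffMeasure_sphere hR,
    ← hn, ← mul_assoc, ← pow_succ', hd, ← integral_const_mul]
  congr 1 with ω
  -- Along a ray the weighted integrand is the derivative of `r ^ n * φ (r • ω)`, which vanishes at
  -- `r = 0`; only the value at `R` survives.
  have hder : ∀ r ∈ uIcc 0 R, HasDerivAt (fun r : ℝ => r ^ n * φ (r • (ω : E)))
      (r ^ (n - 1) * (fderiv ℝ φ (r • (ω : E)) (r • (ω : E)) + n * φ (r • (ω : E)))) r := by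
    intro r _
    have h1 : HasDerivAt (fun r : ℝ => r • (ω : E)) (ω : E) r := by
      simpa using (hasDerivAt_id r).smul_const (ω : E)
    have h2 := ((hφ.differentiable (by simp)) (r • (ω : E))).hasFDerivAt.comp_hasDerivAt r h1
    refine ((hasDerivAt_pow n r).mul h2).congr_deriv ?_
    have hp : r ^ n = r ^ (n - 1) * r := by rw [← pow_succ, hd]
    simp only [map_smul, smul_eq_mul, Function.comp, hp]
    ring
  rw [intervalIntegral.integral_eq_sub_of_hasDerivAt hder
    (Continuous.intervalIntegrable (by fun_prop) _ _)]
  rw [zero_pow (by omega)]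
  simp

theorem euclideanHausdorffMeasure_sphere [Nontrivial E] {R : ℝ} (hR : 0 < R) :
    (μHE[Module.finrank ℝ E - 1] : Measure E) (Metric.sphere 0 R) ≠ 0 ∧
    (μHE[Module.finrank ℝ E - 1] : Measure E) (Metric.sphere 0 R) ≠ ⊤ := by
  have h := congrArg (fun μ : Measure E => μ univ)
    (euclideanHausdorffMeasure_restrict_sphere (E := E) hR)
  simp only [Measure.restrict_apply_univ, Measure.smul_apply, smul_eq_mul] at h
  rw [Measure.map_apply (by fun_prop) .univ, preimage_univ] at h
  rw [h]
  constructor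
  · refine mul_ne_zero (by simpa using pow_pos hR _) ?_
    exact Measure.measure_univ_ne_zero.2 (Measure.toSphere_ne_zero volume)
  · exact ENNReal.mul_ne_top ENNReal.ofReal_ne_top (measure_ne_top _ _)

end Polar

/-! ### Constant solutions in the ball -/

namespace OneLaplace

variable {N : ℕ}

theorem nontrivial_euc (hN : 2 ≤ N) : Nontrivial (Euc N) :=
  Module.nontrivial_of_finrank_pos (R := ℝ) (by rw [finrank_euclideanSpace_fin]; omega)

theorem boundaryMeasure_openBall {R : ℝ} (hR : 0 < R) :
    boundaryMeasure (openBall N R) =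
      (μHE[N - 1] : Measure (Euc N)).restrict (Metric.sphere 0 R) := by
  change (μHE[N - 1] : Measure (Euc N)).restrict (frontier (Metric.ball (0 : Euc N) R)) = _
  rw [frontier_ball _ hR.ne']

theorem isFiniteMeasure_boundaryMeasure_openBall (hN : 2 ≤ N) {R : ℝ} (hR : 0 < R) :
    IsFiniteMeasure (boundaryMeasure (openBall N R)) := by
  have := nontrivial_euc hN
  have h := (euclideanHausdorffMeasure_sphere (E := Euc N) hR).2
  rw [finrank_euclideanSpace_fin] at h
  rw [boundaryMeasure_openBall hR]
  exact ⟨by rw [Measure.restrict_apply_univ]; exact h.lt_top⟩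

theorem isFiniteMeasure_restrict_openBall (N : ℕ) (R : ℝ) :
    IsFiniteMeasure (volume.restrict (openBall N R : Set (Euc N))) :=
  ⟨by rw [Measure.restrict_apply_univ]; exact measure_ball_lt_top⟩

theorem integrableOn_openBall {F : Type*} [NormedAddCommGroup F] {g : Euc N → F}
    (hg : Continuous g) (R : ℝ) : IntegrableOn g (openBall N R : Set (Euc N)) :=
  (hg.locallyIntegrable.integrableOn_isCompact (isCompact_closedBall (0 : Euc N) R)).mono_set
    Metric.ball_subset_closedBall

theorem inner_gradient_eq_fderiv {φ : Euc N → ℝ} (v x : Euc N) :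
    inner ℝ v (gradient φ x) = fderiv ℝ φ x v := by
  rw [real_inner_comm, gradient, InnerProductSpace.toDual_symm_apply]

/-- Green's formula on a ball for the field `x ↦ k x`. -/
theorem setIntegral_openBall_green (hN : 2 ≤ N) {R : ℝ} (hR : 0 < R) (k : ℝ) {φ : Euc N → ℝ}
    (hφ : ContDiff ℝ 1 φ) :
    (∫ x in (openBall N R : Set (Euc N)), inner ℝ (k • x) (gradient φ x)) +
        ∫ x in (openBall N R : Set (Euc N)), φ x * (k * N) =
      ∫ x, φ x * (k * R) ∂boundaryMeasure (openBall N R) := by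
  have := nontrivial_euc hN
  have h := setIntegral_ball_fderiv_apply_add_mul (E := Euc N) hR hφ
  rw [finrank_euclideanSpace_fin, ← boundaryMeasure_openBall hR] at h
  have hcf : Continuous (fderiv ℝ φ) := hφ.continuous_fderiv (by simp)
  have hcφ : Continuous φ := hφ.continuous
  have hc1 : Continuous fun x : Euc N => inner ℝ (k • x) (gradient φ x) := by
    simp_rw [inner_gradient_eq_fderiv]
    fun_prop
  have hc2 : Continuous fun x : Euc N => φ x * (k * N) := by fun_prop
  rw [← integral_add (integrableOn_openBall hc1 R) (integrableOn_openBall hc2 R),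
    integral_mul_const, mul_comm _ (k * R), mul_assoc, ← h, ← integral_const_mul]
  refine integral_congr_ae (ae_of_all _ fun x => ?_)
  simp only [inner_gradient_eq_fderiv, map_smul, smul_eq_mul]
  ring

theorem isDistribGradient_const (Ω : Opens (Euc N)) (c : ℝ) :
    IsDistribGradient Ω (fun _ => c) 0 where
  concentrated := by simp
  finite := by rw [VectorMeasure.variation_zero]; infer_instance
  integral_eq φ := by
    have hφ : ContDiff ℝ 1 φ := φ.contDiff.of_le (by simp)
    have hcf : Continuous (fderiv ℝ φ) := hφ.continuous_fderiv (by simp)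
    have hsupp : HasCompactSupport (gradient (φ : Euc N → ℝ)) :=
      (φ.hasCompactSupport.fderiv ℝ).comp_left (g := (InnerProductSpace.toDual ℝ (Euc N)).symm)
        (map_zero _)
    have hcg : Continuous (gradient (φ : Euc N → ℝ)) :=
      (InnerProductSpace.toDual ℝ (Euc N)).symm.continuous.comp hcf
    have hi : Integrable (gradient (φ : Euc N → ℝ)) := hcg.integrable_of_hasCompactSupport hsupp
    -- Each component of the integral vanishes by parts against the constant one.
    have hzero : ∫ x, gradient (φ : Euc N → ℝ) x = 0 := by
      refine ext_inner_left ℝ fun v => ?_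
      rw [← integral_inner hi, inner_zero_right]
      simp_rw [inner_gradient_eq_fderiv]
      have := integral_mul_fderiv_eq_neg_fderiv_mul_of_integrable (μ := (volume : Measure (Euc N)))
        (f := fun _ => (1 : ℝ)) (g := φ) (v := v) (by simp)
        (by
          simp_rw [one_mul, ← inner_gradient_eq_fderiv]
          exact hi.const_inner v)
        (by simpa using φ.continuous.integrable_of_hasCompactSupport φ.hasCompactSupport)
        (fun x _ => by fun_prop) (fun x _ => (hφ.differentiable (by simp)) x)
      simpa using this
    have hset : ∫ x in (Ω : Set (Euc N)), gradient (φ : Euc N → ℝ) x = 0 := by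
      rw [setIntegral_eq_integral_of_forall_compl_eq_zero, hzero]
      intro x hx
      have : x ∉ tsupport (φ : Euc N → ℝ) := fun h => hx (φ.tsupport_subset h)
      have h0 : fderiv ℝ φ x = 0 := by
        by_contra hne
        exact this (support_fderiv_subset ℝ hne)
      rw [gradient, h0, map_zero]
    rw [integral_smul, hset]
    simp

theorem hasDistribDiv_smul_id (hN : 2 ≤ N) {R : ℝ} (hR : 0 < R) (k : ℝ) :
    HasDistribDiv (openBall N R) (fun x => k • x) (fun _ => k * N) := by
  intro φ
  have h := setIntegral_openBall_green hN hR k (φ.contDiff.of_le (by simp) : ContDiff ℝ 1 φ)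
  have h0 : ∫ x, φ x * (k * R) ∂boundaryMeasure (openBall N R) = 0 := by
    rw [boundaryMeasure_openBall hR]
    refine setIntegral_eq_zero_of_forall_eq_zero fun x hx => ?_
    have hx' : x ∉ tsupport (φ : Euc N → ℝ) := fun h' => by
      have h1 : dist x 0 < R := φ.tsupport_subset h'
      exact h1.ne hx
    rw [image_eq_zero_of_notMem_tsupport hx', zero_mul]
  rw [h0] at h
  simp_rw [mul_comm (k * (N : ℝ))]
  linarith

theorem isWeakNormalTrace_smul_id (hN : 2 ≤ N) {R : ℝ} (hR : 0 < R) (k : ℝ) :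
    IsWeakNormalTrace (openBall N R) (fun x => k • x) (fun _ => k * N) (fun _ => k * R) := by
  have := isFiniteMeasure_boundaryMeasure_openBall hN hR
  exact ⟨memLp_const _, fun φ =>
    setIntegral_openBall_green hN hR k (φ.contDiff.of_le (by simp))⟩

/-- A constant `c` solves the problem in the ball of radius `R` with the field `x ↦ k x`,
where `|k| = 1 / R`, as soon as `f c = -k N` and the boundary condition holds. -/
theorem isSolutionPair_const (hN : 2 ≤ N) {R : ℝ} (hR : 0 < R) {f : ℝ → ℝ} {c k : ℝ}
    (hk : |k| * R = 1) (hf : f c = -(k * N)) (hsign : k * R ∈ multiSign (-c)) :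
    IsSolutionPair (openBall N R) (fun _ => f) (fun _ => c) (fun x => k • x) := by
  have := isFiniteMeasure_boundaryMeasure_openBall hN hR
  have := isFiniteMeasure_restrict_openBall N R
  have hg : (fun _ : Euc N => -f c) = fun _ => k * N := by rw [hf, neg_neg]
  refine ⟨⟨integrable_const c, 0, isDistribGradient_const _ c⟩, ⟨by fun_prop, ?_⟩,
    memLp_const _, ?_, ⟨0, isDistribGradient_const _ c, fun φ => ?_⟩,
    fun _ => c, fun _ => k * R, ⟨integrable_const _, ae_of_all _ fun x => ?_⟩, ?_,
    ae_of_all _ fun _ => hsign⟩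
  · filter_upwards [ae_restrict_mem (openBall N R).isOpen.measurableSet] with x hx
    have hx' : ‖x‖ < R := mem_ball_zero_iff.1 hx
    rw [norm_smul, Real.norm_eq_abs, ← hk]
    gcongr
  · simp only [hg]
    exact hasDistribDiv_smul_id hN hR k
  -- Since `Du = 0`, the pairing must vanish, and it is `c` times the distributional equation for
  -- the field.
  · have h := hasDistribDiv_smul_id hN hR k φ
    rw [VectorMeasure.variation_zero, integral_zero_measure, anzellottiPairing]
    simp only [hf, neg_neg, mul_assoc, integral_const_mul] at h ⊢
    rw [h]
    simp only [mul_comm _ (k * (N : ℝ)), ← mul_assoc, integral_const_mul]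
    ring
  · simp
  · simp only [hg]
    exact isWeakNormalTrace_smul_id hN hR k

/-- Every small ball around a boundary point meets the domain in positive measure, so the averages
all equal `|c - τ x|`, and their limit is zero. -/
theorem boundaryTrace_eq_of_ae_eq_const {R : ℝ} (hR : 0 < R) {u τ : Euc N → ℝ} {c : ℝ}
    (hu : ∀ᵐ x ∂volume.restrict (openBall N R : Set (Euc N)), u x = c)
    (hτ : IsBoundaryTrace (openBall N R) u τ) :
    ∀ᵐ x ∂boundaryMeasure (openBall N R), τ x = c := by
  have h := hτ.2
  rw [boundaryMeasure_openBall hR] at h ⊢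
  filter_upwards [h, ae_restrict_mem Metric.isClosed_sphere.measurableSet] with x hx hxs
  have hev : ∀ r ∈ Ioi (0 : ℝ), ⨍ y in Metric.ball x r ∩ (openBall N R : Set (Euc N)),
      |u y - τ x| = |c - τ x| := by
    intro r hr
    have hne : (Metric.ball x r ∩ (openBall N R : Set (Euc N))).Nonempty := by
      have hcl : x ∈ closure (openBall N R : Set (Euc N)) := by
        change x ∈ closure (Metric.ball (0 : Euc N) R)
        rw [closure_ball _ hR.ne']
        exact Metric.sphere_subset_closedBall hxs
      exact mem_closure_iff.1 hcl _ Metric.isOpen_ball (Metric.mem_ball_self hr)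
    have hpos : volume (Metric.ball x r ∩ (openBall N R : Set (Euc N))) ≠ 0 :=
      ((Metric.isOpen_ball.inter (openBall N R).isOpen).measure_pos volume hne).ne'
    have hfin : volume (Metric.ball x r ∩ (openBall N R : Set (Euc N))) ≠ ⊤ :=
      ((measure_mono inter_subset_left).trans_lt measure_ball_lt_top).ne
    have hae : (fun y => |u y - τ x|) =ᵐ[volume.restrict
        (Metric.ball x r ∩ (openBall N R : Set (Euc N)))] fun _ => |c - τ x| := by
      filter_upwards [ae_restrict_of_ae_restrict_of_subset inter_subset_right hu] with y hy
      rw [hy]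
    rw [average_congr hae, setAverage_const hpos hfin]
  have hlim : Tendsto (fun _ : ℝ => |c - τ x|) (𝓝[>] 0) (𝓝 0) :=
    hx.congr' (eventually_of_mem self_mem_nhdsWithin hev)
  have := tendsto_nhds_unique hlim tendsto_const_nhds
  have := abs_eq_zero.1 this.symm
  linarith

/-- If a field on the ball of radius `R` has constant divergence `b` and constant normal trace `t`,
then `b * R = t * N`. -/
theorem eq_of_isWeakNormalTrace_const (hN : 2 ≤ N) {R : ℝ} (hR : 0 < R) {z : Euc N → Euc N}
    {g θ : Euc N → ℝ} {b t : ℝ}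
    (hg : ∀ᵐ x ∂volume.restrict (openBall N R : Set (Euc N)), g x = b)
    (hθ : ∀ᵐ x ∂boundaryMeasure (openBall N R), θ x = t)
    (h : IsWeakNormalTrace (openBall N R) z g θ) : b * R = t * N := by
  have := nontrivial_euc hN
  have hfin := isFiniteMeasure_boundaryMeasure_openBall hN hR
  -- This cutoff is one on a neighbourhood of the closed ball, so the gradient term in Green's
  -- formula disappears.
  let B : ContDiffBump (0 : Euc N) := ⟨R + 1, R + 2, by linarith, by linarith⟩
  let φ : 𝓓((⊤ : Opens (Euc N)), ℝ) := ⟨B, B.contDiff, B.hasCompactSupport, by simp⟩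
  have hφ1 : ∀ x ∈ Metric.ball (0 : Euc N) (R + 1), φ x = 1 := fun x hx =>
    B.one_of_mem_closedBall (Metric.ball_subset_closedBall hx)
  have hgrad : ∀ x ∈ (openBall N R : Set (Euc N)), gradient (φ : Euc N → ℝ) x = 0 := by
    intro x hx
    have hx' : x ∈ Metric.ball (0 : Euc N) (R + 1) := Metric.ball_subset_ball (by linarith) hx
    have : (φ : Euc N → ℝ) =ᶠ[𝓝 x] fun _ => 1 :=
      eventually_of_mem (Metric.isOpen_ball.mem_nhds hx') hφ1
    rw [gradient, this.fderiv_eq]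
    simp
  have key : ∀ (w : Euc N → Euc N) (g' θ' : Euc N → ℝ) (b' t' : ℝ),
      (∀ᵐ x ∂volume.restrict (openBall N R : Set (Euc N)), g' x = b') →
      (∀ᵐ x ∂boundaryMeasure (openBall N R), θ' x = t') →
      IsWeakNormalTrace (openBall N R) w g' θ' →
      (volume.real (openBall N R : Set (Euc N))) * b' =
        (boundaryMeasure (openBall N R)).real univ * t' := by
    intro w g' θ' b' t' hg' hθ' h'
    have h2 := h'.2 φ
    have e1 : ∫ x in (openBall N R : Set (Euc N)), inner ℝ (w x) (gradient (φ : Euc N → ℝ) x) = 0 :=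
      setIntegral_eq_zero_of_forall_eq_zero fun x hx => by rw [hgrad x hx, inner_zero_right]
    have e2 : ∫ x in (openBall N R : Set (Euc N)), φ x * g' x =
        ∫ x in (openBall N R : Set (Euc N)), b' := by
      refine integral_congr_ae ?_
      filter_upwards [hg', ae_restrict_mem (openBall N R).isOpen.measurableSet] with x hx hxb
      rw [hx, hφ1 x (Metric.ball_subset_ball (by linarith) hxb), one_mul]
    have e3 : ∫ x, φ x * θ' x ∂boundaryMeasure (openBall N R) =
        ∫ x, t' ∂boundaryMeasure (openBall N R) := by
      refine integral_congr_ae ?_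
      have hm : ∀ᵐ x ∂boundaryMeasure (openBall N R), x ∈ Metric.sphere (0 : Euc N) R := by
        rw [boundaryMeasure_openBall hR]
        exact ae_restrict_mem Metric.isClosed_sphere.measurableSet
      filter_upwards [hθ', hm] with x hx hxs
      rw [hx, hφ1 x (by rw [Metric.mem_ball, Metric.mem_sphere.1 hxs]; linarith), one_mul]
    rw [e1, e2, e3, zero_add, setIntegral_const, integral_const] at h2
    simpa using h2
  have h1 := key _ _ _ _ _ hg hθ h
  -- The field `x` supplies the ratio of volume to surface measure without computing either.
  have h2 := key _ _ _ _ _ (ae_of_all _ fun _ => rfl) (ae_of_all _ fun _ => rfl)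
    (isWeakNormalTrace_smul_id hN hR 1)
  have hS : (boundaryMeasure (openBall N R)).real univ ≠ 0 := by
    refine (measureReal_ne_zero_iff).2 ?_
    rw [boundaryMeasure_openBall hR, Measure.restrict_apply_univ]
    simpa using (euclideanHausdorffMeasure_sphere (E := Euc N) hR).1
  have hb : (boundaryMeasure (openBall N R)).real univ * (b * R) =
      (boundaryMeasure (openBall N R)).real univ * (t * N) := by
    linear_combination (N : ℝ) * h1 - b * h2
  exact mul_left_cancel₀ hS hb

/-- When the sign set at `-c` is a singleton, the boundary condition prescribes the normal trace
almost everywhere, and Green's formula fixes `f c`. -/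
theorem apply_const_eq_of_isSolution (hN : 2 ≤ N) {R : ℝ} (hR : 0 < R) {f : ℝ → ℝ}
    {u : Euc N → ℝ} {c t : ℝ}
    (hu : ∀ᵐ x ∂volume.restrict (Metric.ball (0 : Euc N) R), u x = c)
    (h : IsSolution (openBall N R) (fun _ => f) u) (ht : multiSign (-c) = {t}) :
    f c = -t * N / R := by
  obtain ⟨z, hz⟩ := h
  obtain ⟨τ, θ, hτ, hθ, hsign⟩ := hz.boundary
  have hθt : ∀ᵐ x ∂boundaryMeasure (openBall N R), θ x = t := by
    filter_upwards [hsign, boundaryTrace_eq_of_ae_eq_const hR hu hτ] with x hx hxc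
    rwa [hxc, ht] at hx
  have hg : ∀ᵐ x ∂volume.restrict (openBall N R : Set (Euc N)), -f (u x) = -f c := by
    filter_upwards [hu] with x hx
    rw [hx]
  have := eq_of_isWeakNormalTrace_const hN hR hg hθt hθ
  rw [eq_div_iff hR.ne']
  linarith

end OneLaplace

theorem mainTheorem5 (N : ℕ) (hN : 2 ≤ N) (R : ℝ) (hR : 0 < R) :
    (∀ q : ℝ, 0 < q →
      (0 < ((N : ℝ) / R) ^ (1 / q) ∧
        OneLaplace.IsSolutionPair (OneLaplace.openBall N R) (fun _ s => |s| ^ (q - 1) * s)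
          (fun _ => ((N : ℝ) / R) ^ (1 / q)) (fun x => -(R⁻¹ • x))) ∧
      (-((N : ℝ) / R) ^ (1 / q) < 0 ∧
        OneLaplace.IsSolutionPair (OneLaplace.openBall N R) (fun _ s => |s| ^ (q - 1) * s)
          (fun _ => -((N : ℝ) / R) ^ (1 / q)) (fun x => R⁻¹ • x))) ∧
    (∀ f : ℝ → ℝ, Continuous f → StrictMono f →
      ∀ (u : OneLaplace.Euc N → ℝ) (c : ℝ),
        (∀ᵐ x ∂(volume.restrict (Metric.ball (0 : OneLaplace.Euc N) R)), u x = c) →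
        OneLaplace.IsSolution (OneLaplace.openBall N R) (fun _ => f) u →
        (0 < c → (N : ℝ) / R ∈ Set.range f ∧ c = Function.invFun f ((N : ℝ) / R)) ∧
        (c < 0 → -((N : ℝ) / R) ∈ Set.range f ∧ c = Function.invFun f (-((N : ℝ) / R)))) := by
  have hNpos : (0 : ℝ) < N := by exact_mod_cast (by omega : 0 < N)
  refine ⟨fun q hq => ?_, fun f _ hf u c hu hsol => ⟨fun hc => ?_, fun hc => ?_⟩⟩
  · have hNR : 0 < (N : ℝ) / R := by positivity
    set a : ℝ := ((N : ℝ) / R) ^ (1 / q) with ha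
    have ha0 : 0 < a := Real.rpow_pos_of_pos hNR _
    have haq : a ^ (q - 1) * a = N / R := by
      rw [Real.rpow_sub_one ha0.ne', div_mul_cancel₀ _ ha0.ne', ha, ← Real.rpow_mul hNR.le,
        one_div_mul_cancel hq.ne', Real.rpow_one]
    have hRabs : |R⁻¹| * R = 1 := by rw [abs_of_pos (inv_pos.2 hR), inv_mul_cancel₀ hR.ne']
    refine ⟨⟨ha0, ?_⟩, neg_lt_zero.2 ha0, ?_⟩
    · have h := OneLaplace.isSolutionPair_const hN hR (f := fun s => |s| ^ (q - 1) * s) (c := a)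
        (k := -R⁻¹) (by rwa [abs_neg])
        (by simp only [abs_of_pos ha0, haq]; ring)
        (by simp [OneLaplace.multiSign, ha0, ha0.not_gt, hR.ne'])
      simpa only [neg_smul] using h
    · exact OneLaplace.isSolutionPair_const hN hR (f := fun s => |s| ^ (q - 1) * s) (c := -a)
        (k := R⁻¹) hRabs
        (by simp only [abs_neg, abs_of_pos ha0, mul_neg, haq]; ring)
        (by simp [OneLaplace.multiSign, ha0, hR.ne'])
  · have h := OneLaplace.apply_const_eq_of_isSolution hN hR hu hsol (t := -1)
      (by simp [OneLaplace.multiSign, hc, hc.le])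
    rw [neg_neg, one_mul] at h
    exact ⟨⟨c, h⟩, by rw [← h, Function.leftInverse_invFun hf.injective c]⟩
  · have h := OneLaplace.apply_const_eq_of_isSolution hN hR hu hsol (t := 1)
      (by simp [OneLaplace.multiSign, hc])
    rw [neg_one_mul, neg_div] at h
    exact ⟨⟨c, h⟩, by rw [← h, Function.leftInverse_invFun hf.injective c]⟩
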